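/- Conventions. All hypergraphs are finite. The VC-dimension of a graph $G=(V,E)$ is the largest $d\ge 0$ for which there are vertices $a_i$ ($i\in[d]$) and $b_S$ ($S\subseteq[d]$) in $V$ such that, for all $i\in[d]$ and $S\subseteq[d]$, $a_ib_S\in E$ if and only if $i\in S$. For a $3$-uniform hypergraph $H=(V,F)$ and $x\in V$, the slice graph $H_x$ is the graph on $V$ with edge set $\{yz : xyz\in F\}$; the slicewise VC-dimension of $H$ is the maximum over $x\in V$ of the VC-dimension of $H_x$. For nonempty $X,Y,Z\subseteq V$ put $d_H(X,Y,Z)=|\{(x,y,z)\in X\times Y\times Z: \{x,y,z\}\in F\}|/(|X||Y||Z|)$, and call $(X,Y,Z)$ $\epsilon$-homogeneous if $d_H(X,Y,Z)\in[0,\epsilon)\cup(1-\epsilon,1]$. A partition $\mathcal P$ of $V$ is $\epsilon$-homogeneous for $H$ if at least $(1-\epsilon)|V|^3$ of the triples $(x,y,z)\in V^3$ lie in $X\times Y\times Z$ for some $\epsilon$-homogeneous triple $(X,Y,Z)\in\mathcal P^3$. **Theorem 1.4.** For every integer $k\ge 1$ there are real numbers $K,\epsilon^*>0$ such that for every $\epsilon$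 with $0<\epsilon<\epsilon^*$ there is $N\in\mathbb N$ such that every $3$-uniform hypergraph $H$ with at least $N$ vertices and slicewise VC-dimension less than $k$ has an $\epsilon$-homogeneous partition with at most $2^{2^{\epsilon^{-K}}}$ parts. -/

import Mathlib

structure ThreeGraph (V : Type*) where
  edges : Finset (Finset V)
  card_eq_three : ∀ e ∈ edges, e.card = 3

/-- There are vertices `a i` for `i ∈ [d]` and `b S` for `S ⊆ [d]` such that `a i` and `b S` are
adjacent if and only if `i ∈ S`. -/
def SimpleGraph.HasShattered {V : Type*} (G : SimpleGraph V) (d : ℕ) : Prop :=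
  ∃ (a : Fin d → V) (b : Finset (Fin d) → V),
    ∀ (i : Fin d) (S : Finset (Fin d)), G.Adj (a i) (b S) ↔ i ∈ S

/-- The VC-dimension of a graph: the largest `d` such that `G.HasShattered d`
(the supremum, taken in `ℕ∞`, hence the maximum when `V` is finite and nonempty). -/
noncomputable def SimpleGraph.vcDimension {V : Type*} (G : SimpleGraph V) : ℕ∞ :=
  ⨆ (d : ℕ) (_ : G.HasShattered d), (d : ℕ∞)

namespace ThreeGraph

/-- The slice graph `H_x`: the graph on all of `V` whose edges are the pairs `yz` with
`xyz` an edge of `H`. -/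
def slice {V : Type*} [DecidableEq V] (H : ThreeGraph V) (x : V) : SimpleGraph V where
  Adj y z := y ≠ z ∧ ({x, y, z} : Finset V) ∈ H.edges
  symm := ⟨fun y z h => ⟨h.1.symm, by rw [Finset.pair_comm z y]; exact h.2⟩⟩
  loopless := ⟨fun _ h => h.1 rfl⟩

/-- The slicewise VC-dimension of `H`: the maximum of the VC-dimensions of its slice graphs. -/
noncomputable def slicewiseVC {V : Type*} [DecidableEq V] (H : ThreeGraph V) : ℕ∞ :=
  ⨆ x : V, (H.slice x).vcDimension

/-- The density `d_H(X, Y, Z)`: the proportion of triples `(x, y, z) ∈ X × Y × Z` such that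
`xyz` is an edge of `H`. -/
noncomputable def density {V : Type*} [DecidableEq V] (H : ThreeGraph V)
    (X Y Z : Finset V) : ℝ :=
  (((X ×ˢ Y ×ˢ Z).filter
      fun t : V × V × V => ({t.1, t.2.1, t.2.2} : Finset V) ∈ H.edges).card : ℝ) /
    ((X.card : ℝ) * (Y.card : ℝ) * (Z.card : ℝ))

/-- The triple `(X, Y, Z)` is `ε`-homogeneous: its density lies in `[0, ε) ∪ (1 - ε, 1]`. -/
def IsHomogeneousTriple {V : Type*} [DecidableEq V] (H : ThreeGraph V) (ε : ℝ)
    (X Y Z : Finset V) : Prop :=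
  H.density X Y Z ∈ Set.Ico (0 : ℝ) ε ∪ Set.Ioc (1 - ε) 1

open Classical in
/-- The partition `P` of `V` is `ε`-homogeneous: at least `(1 - ε)|V|³` of the triples
`(x, y, z) ∈ V³` lie in `X × Y × Z` for some `ε`-homogeneous triple `(X, Y, Z)` of parts. -/
def IsHomogeneousPartition {V : Type*} [Fintype V] [DecidableEq V] (H : ThreeGraph V) (ε : ℝ)
    (P : Finpartition (Finset.univ : Finset V)) : Prop :=
  (1 - ε) * (Fintype.card V : ℝ) ^ 3 ≤
    ((Finset.univ.filter fun t : V × V × V =>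
      ∃ X ∈ P.parts, ∃ Y ∈ P.parts, ∃ Z ∈ P.parts,
        H.IsHomogeneousTriple ε X Y Z ∧ t.1 ∈ X ∧ t.2.1 ∈ Y ∧ t.2.2 ∈ Z).card : ℝ)

end ThreeGraph

/-!
Color the vertices so that vertices of the same color have, on average, almost equal slices.
Replacing the three vertices of a random triple one at a time by random vertices of the same color
then rarely changes whether they span an edge, so that on average the edge indicator is close to
the density of the triple of color classes. As this density is far from both `0` and `1` on an
inhomogeneous triple, Markov's inequality makes the color classes a homogeneous partition.

The coloring comes from sampling twice. A sample `t` of `r` vertices almost determines the row of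
`x` in each of the relations `T · y ·` through its trace on `t`, and a sample `w` of about `r ^ 2`
vertices almost determines the rows of `x` in the `r` relations `T · · (t i)`. The color of `x`
records on which pairs `(w j, t i)` the relation `T x` holds. The mean error of a sample of size
`r` is a leave-one-out error, which the one-inclusion graph of a family of VC-dimension `k` bounds
by `2 * k / (r + 1)`.
-/

open Finset
open scoped BigOperators

section OneInclusion

variable {α : Type*}

open Classical in
/-- The family of subsets of `u` of positive weight. -/
noncomputable def weightSupport (u : Finset α) (p : Finset α → ℝ) : Finset (Finset α) :=
  {s ∈ u.powerset | 0 < p s}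

variable {u s : Finset α} {a : α} {p q : Finset α → ℝ}

theorem mem_weightSupport : s ∈ weightSupport u p ↔ s ⊆ u ∧ 0 < p s := by
  simp [weightSupport]

variable [DecidableEq α]

/-- The total weight of the one-inclusion graph (the Hamming cube) on the subsets of `u`, where an
edge gets the smaller of the weights `p` of its two ends. -/
noncomputable def edgeWeight (u : Finset α) (p : Finset α → ℝ) : ℝ :=
  ∑ a ∈ u, ∑ s ∈ (u.erase a).powerset, min (p s) (p (insert a s))

theorem subset_of_weightSupport_shatters (hs : (weightSupport u p).Shatters s) : s ⊆ u :=
  let ⟨_, ht, hst⟩ := hs.exists_superset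
  hst.trans (mem_weightSupport.1 ht).1

theorem edgeWeight_insert (ha : a ∉ u) :
    edgeWeight (insert a u) p = edgeWeight u p + edgeWeight u (fun s ↦ p (insert a s)) +
      ∑ s ∈ u.powerset, min (p s) (p (insert a s)) := by
  have hterm (b : α) (hb : b ∈ u) :
      ∑ s ∈ ((insert a u).erase b).powerset, min (p s) (p (insert b s)) =
        ∑ s ∈ (u.erase b).powerset, min (p s) (p (insert b s)) +
          ∑ s ∈ (u.erase b).powerset, min (p (insert a s)) (p (insert a (insert b s))) := by
    have hab : a ≠ b := fun h ↦ ha (h ▸ hb)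
    rw [erase_insert_of_ne hab, sum_powerset_insert fun h ↦ ha (mem_of_mem_erase h)]
    simp only [insert_comm b a]
  rw [edgeWeight, sum_insert ha, erase_insert ha, sum_congr rfl hterm, sum_add_distrib, add_comm]
  rfl

theorem edgeWeight_add_le_sup_add_inf :
    edgeWeight u p + edgeWeight u q ≤ edgeWeight u (p ⊔ q) + edgeWeight u (p ⊓ q) := by
  simp only [edgeWeight, ← sum_add_distrib, Pi.sup_apply, Pi.inf_apply]
  refine sum_le_sum fun a _ ↦ sum_le_sum fun s _ ↦ ?_
  grind

theorem shatters_of_weightSupport_sup (ha : a ∉ u)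
    (hs : (weightSupport u (p ⊔ fun s ↦ p (insert a s))).Shatters s) :
    (weightSupport (insert a u) p).Shatters s := by
  have has : a ∉ s := fun h ↦ ha (subset_of_weightSupport_shatters hs h)
  intro t ht
  obtain ⟨v, hv, rfl⟩ := hs ht
  obtain ⟨hvu, hpos⟩ := mem_weightSupport.1 hv
  rcases lt_sup_iff.1 hpos with hpv | hpv
  · exact ⟨v, mem_weightSupport.2 ⟨hvu.trans (subset_insert a u), hpv⟩, rfl⟩
  · exact ⟨insert a v, mem_weightSupport.2 ⟨insert_subset_insert a hvu, hpv⟩,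
      inter_insert_of_notMem has⟩

theorem shatters_insert_of_weightSupport_inf (ha : a ∉ u)
    (hs : (weightSupport u (p ⊓ fun s ↦ p (insert a s))).Shatters s) :
    (weightSupport (insert a u) p).Shatters (insert a s) := by
  intro t ht
  obtain ⟨v, hv, hvt⟩ := hs (subset_insert_iff.1 ht)
  obtain ⟨hvu, hpos⟩ := mem_weightSupport.1 hv
  obtain ⟨hpv, hpav⟩ := lt_inf_iff.1 hpos
  by_cases hat : a ∈ t
  · refine ⟨insert a v, mem_weightSupport.2 ⟨insert_subset_insert a hvu, hpav⟩, ?_⟩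
    rw [← insert_inter_distrib, hvt, insert_erase hat]
  · refine ⟨v, mem_weightSupport.2 ⟨hvu.trans (subset_insert a u), hpv⟩, ?_⟩
    rw [insert_inter_of_notMem fun h ↦ ha (hvu h), hvt, erase_eq_of_notMem hat]

/-- A weighted form of Haussler's bound on the density of the one-inclusion graph. In the induction
`p ⊔ pa` and `p ⊓ pa` share out the weight of the two halves of the cube, and the edges between the
halves are paid for by the support of `p ⊓ pa`, which shatters smaller sets only. -/
theorem edgeWeight_le {d : ℝ} (hp : 0 ≤ p)
    (hd : ∀ s, (weightSupport u p).Shatters s → (#s : ℝ) ≤ d) :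
    edgeWeight u p ≤ d * ∑ s ∈ u.powerset, p s := by
  induction u using Finset.induction_on generalizing p d with
  | empty =>
    simp only [edgeWeight, sum_empty, powerset_empty, sum_singleton]
    rcases (hp ∅).eq_or_lt with h0 | hpos
    · simp [← h0]
    · have hd0 : 0 ≤ d := by
        simpa using hd ∅ (shatters_empty.2 ⟨∅, mem_weightSupport.2 ⟨subset_rfl, hpos⟩⟩)
      exact mul_nonneg hd0 (hp ∅)
  | insert a u ha ih =>
    set pa : Finset α → ℝ := fun s ↦ p (insert a s)
    have hpa : 0 ≤ pa := fun s ↦ hp (insert a s)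
    have hsup := ih (hp.trans le_sup_left) fun s hs ↦ hd s (shatters_of_weightSupport_sup ha hs)
    have hinf := ih (p := p ⊓ pa) (d := d - 1) (le_inf hp hpa) fun s hs ↦ by
      have has : a ∉ s := fun h ↦ ha (subset_of_weightSupport_shatters hs h)
      have hcard := hd (insert a s) (shatters_insert_of_weightSupport_inf ha hs)
      rw [card_insert_of_notMem has, Nat.cast_succ] at hcard
      linarith
    have htotal : ∑ s ∈ u.powerset, (p ⊔ pa) s + ∑ s ∈ u.powerset, (p ⊓ pa) s =
        ∑ s ∈ (insert a u).powerset, p s := by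
      rw [sum_powerset_insert ha, ← sum_add_distrib, ← sum_add_distrib]
      exact sum_congr rfl fun s _ ↦ max_add_min (p s) (pa s)
    calc edgeWeight (insert a u) p
        = edgeWeight u p + edgeWeight u pa + ∑ s ∈ u.powerset, (p ⊓ pa) s := edgeWeight_insert ha
      _ ≤ edgeWeight u (p ⊔ pa) + edgeWeight u (p ⊓ pa) + ∑ s ∈ u.powerset, (p ⊓ pa) s :=
        add_le_add_left edgeWeight_add_le_sup_add_inf _
      _ ≤ d * ∑ s ∈ u.powerset, (p ⊔ pa) s + (d - 1) * ∑ s ∈ u.powerset, (p ⊓ pa) s +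
            ∑ s ∈ u.powerset, (p ⊓ pa) s := by gcongr
      _ = d * ∑ s ∈ (insert a u).powerset, p s := by rw [← htotal]; ring

end OneInclusion

section Fiber

variable {X C : Type*} [Fintype X]

open Classical in
/-- The color class of `x` under the coloring `f`. -/
noncomputable def fiber (f : X → C) (x : X) : Finset X := {x' | f x' = f x}

variable {f : X → C} {x x' : X}

theorem mem_fiber : x' ∈ fiber f x ↔ f x' = f x := by simp [fiber]

theorem fiber_nonempty (f : X → C) (x : X) : (fiber f x).Nonempty := ⟨x, mem_fiber.2 rfl⟩

theorem fiber_congr (h : f x' = f x) : fiber f x' = fiber f x := by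
  ext; rw [mem_fiber, mem_fiber, h]

theorem expect_expect_fiber_comm (f : X → C) (F : X → X → ℝ) :
    𝔼 x, 𝔼 x' ∈ fiber f x, F x x' = 𝔼 x, 𝔼 x' ∈ fiber f x, F x' x := by
  simp only [expect_eq_sum_div_card, sum_div]
  rw [sum_comm' (t' := univ) (s' := fiber f) fun x x' ↦ by simp [mem_fiber, eq_comm]]
  refine sum_congr rfl fun x _ ↦ sum_congr rfl fun x' hx' ↦ ?_
  rw [fiber_congr (mem_fiber.1 hx')]

theorem expect_expect_fiber (f : X → C) (g : X → ℝ) :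
    𝔼 x, 𝔼 x' ∈ fiber f x, g x' = 𝔼 x, g x := by
  rw [expect_expect_fiber_comm]
  simp only [expect_const (fiber_nonempty f _)]

theorem expect_expect_fiber_add (f : X → C) (c : X → ℝ) :
    𝔼 x, 𝔼 x' ∈ fiber f x, (c x + c x') = 2 * 𝔼 x, c x := by
  simp only [expect_add_distrib, expect_expect_fiber, expect_const (fiber_nonempty f _), two_mul]

end Fiber

section Iverson

open Classical in
/-- The truth value of `p` as a real number, so that `|iverson p - iverson q|` indicates that `p`
and `q` disagree. -/
noncomputable def iverson (p : Prop) : ℝ := if p then 1 else 0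

theorem iverson_nonneg (p : Prop) : 0 ≤ iverson p := by
  unfold iverson; positivity

theorem iverson_le_one (p : Prop) : iverson p ≤ 1 := by
  unfold iverson; split_ifs <;> norm_num

theorem abs_iverson_sub_le_one (p q : Prop) : |iverson p - iverson q| ≤ 1 :=
  abs_sub_le_of_nonneg_of_le (iverson_nonneg p) (iverson_le_one p) (iverson_nonneg q)
    (iverson_le_one q)

theorem abs_iverson_sub_eq_one {p q : Prop} (h : ¬(p ↔ q)) : |iverson p - iverson q| = 1 := by
  by_cases p <;> by_cases q <;> simp_all [iverson]

end Iverson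

theorem sum_expect_abs_sub_le {X : Type*} (F : Finset X) {g : X → ℝ} (hg : ∀ x, 0 ≤ g x) :
    ∑ x ∈ F, 𝔼 x' ∈ F, |g x - g x'| ≤ 2 * ∑ x ∈ F, g x := by
  rcases F.eq_empty_or_nonempty with rfl | hF
  · simp
  calc ∑ x ∈ F, 𝔼 x' ∈ F, |g x - g x'|
      ≤ ∑ x ∈ F, 𝔼 x' ∈ F, (g x + g x') := by
        refine sum_le_sum fun x _ ↦ expect_le_expect fun x' _ ↦ abs_le.2 ⟨?_, ?_⟩ <;>
          linarith [hg x, hg x']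
    _ = 2 * ∑ x ∈ F, g x := by
        simp only [expect_add_distrib, expect_const hF, sum_add_distrib, sum_const,
          card_smul_expect]
        ring

theorem sum_expect_abs_iverson_sub_le {X : Type*} (F : Finset X) (q : X → Prop)
    [DecidablePred q] :
    ∑ x ∈ F, 𝔼 x' ∈ F, |iverson (q x) - iverson (q x')| ≤
      2 * min (#{x ∈ F | ¬q x} : ℝ) #{x ∈ F | q x} := by
  have hcount (q : X → Prop) [DecidablePred q] : ∑ x ∈ F, iverson (q x) = #{x ∈ F | q x} := by
    rw [card_filter, Nat.cast_sum]
    refine sum_congr rfl fun x _ ↦ ?_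
    by_cases q x <;> simp [iverson, *]
  have hnot (x x' : X) : |iverson (q x) - iverson (q x')| =
      |iverson (¬q x) - iverson (¬q x')| := by
    by_cases q x <;> by_cases q x' <;> simp [iverson, *]
  rw [mul_min_of_nonneg _ _ zero_le_two, le_min_iff, ← hcount, ← hcount]
  refine ⟨?_, sum_expect_abs_sub_le F fun x ↦ iverson_nonneg (q x)⟩
  simp only [hnot]
  exact sum_expect_abs_sub_le F fun x ↦ iverson_nonneg (¬q x)

/-- Deleting the coordinate `j` only confuses traces that are adjacent in direction `j`. -/
theorem sum_expect_fiber_erase_le {X ι : Type*} [Fintype X] [Fintype ι] [DecidableEq ι]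
    (A : X → Finset ι) (j : ι) :
    ∑ x, 𝔼 x' ∈ fiber (fun x ↦ (A x).erase j) x, |iverson (j ∈ A x) - iverson (j ∈ A x')| ≤
      2 * ∑ s ∈ (univ.erase j).powerset, min (#{x | A x = s} : ℝ) #{x | A x = insert j s} := by
  rw [mul_sum, ← sum_fiberwise_of_maps_to (g := fun x ↦ (A x).erase j)
    fun x _ ↦ mem_powerset.2 (erase_subset_erase j (subset_univ (A x)))]
  refine sum_le_sum fun s hs ↦ ?_
  have hj : j ∉ s := fun h ↦ notMem_erase j univ (mem_powerset.1 hs h)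
  set F : Finset X := {x | (A x).erase j = s}
  have hfiber (x : X) (hx : x ∈ F) : fiber (fun x ↦ (A x).erase j) x = F := by
    ext x'
    rw [mem_fiber, (mem_filter.1 hx).2, mem_filter_univ]
  refine (sum_congr rfl fun x hx ↦ by rw [hfiber x hx]).trans_le
    ((sum_expect_abs_iverson_sub_le F fun x ↦ j ∈ A x).trans_eq ?_)
  congr 4 <;> ext x <;> simp only [F, mem_filter, mem_univ, true_and]
  · exact ⟨fun h ↦ by rw [← h.1, erase_eq_of_notMem h.2], fun h ↦ by simp [h, hj]⟩
  · exact ⟨fun h ↦ by rw [← h.1, insert_erase h.2], fun h ↦ by simp [h, hj]⟩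

theorem sum_sum_expect_fiber_erase_le {X ι : Type*} [Fintype X] [Fintype ι] [DecidableEq ι]
    (A : X → Finset ι) :
    ∑ j, ∑ x, 𝔼 x' ∈ fiber (fun x ↦ (A x).erase j) x, |iverson (j ∈ A x) - iverson (j ∈ A x')| ≤
      2 * ((univ.image A).vcDim * Fintype.card X) := by
  set p : Finset ι → ℝ := fun s ↦ #{x | A x = s}
  have hsupport : weightSupport univ p ⊆ univ.image A := fun s hs ↦ by
    obtain ⟨x, hx⟩ := card_pos.1 (Nat.cast_pos.1 (mem_weightSupport.1 hs).2)
    exact mem_image.2 ⟨x, mem_univ x, (mem_filter.1 hx).2⟩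
  have htotal : ∑ s ∈ univ.powerset, p s = Fintype.card X := by
    rw [← Nat.cast_sum, ← card_univ, card_eq_sum_card_fiberwise (f := A) (t := univ.powerset)
      fun x _ ↦ by simp]
  calc _ ≤ ∑ j, 2 * ∑ s ∈ (univ.erase j).powerset, min (p s) (p (insert j s)) :=
        sum_le_sum fun j _ ↦ sum_expect_fiber_erase_le A j
    _ = 2 * edgeWeight univ p := by rw [edgeWeight, mul_sum]
    _ ≤ _ := by
        rw [← htotal]
        gcongr
        exact edgeWeight_le (fun _ ↦ Nat.cast_nonneg _) fun s hs ↦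
          Nat.cast_le.2 (hs.mono_left hsupport).card_le_vcDim

section Sampling

variable {X Y : Type*}

/-- The sets `{y | R x y}` shatter some `k` points: the shattering condition behind the
VC-dimension, for a relation between two types. -/
def RelShatters (R : X → Y → Prop) (k : ℕ) : Prop :=
  ∃ (a : Fin k → Y) (b : Finset (Fin k) → X), ∀ i S, R (b S) (a i) ↔ i ∈ S

open Classical in
/-- The trace of `x` on a sample `t`: the set of indices of the sample points related to `x`. -/
noncomputable def relTrace {ι : Type*} [Fintype ι] (R : X → Y → Prop) (t : ι → Y) (x : X) :
    Finset ι :=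
  {j | R x (t j)}

theorem mem_relTrace {ι : Type*} [Fintype ι] {R : X → Y → Prop} {t : ι → Y} {x : X} {j : ι} :
    j ∈ relTrace R t x ↔ R x (t j) := by
  simp [relTrace]

theorem fiber_relTrace_removeNth [Fintype X] (R : X → Y → Prop) {r : ℕ}
    (t : Fin (r + 1) → Y) (j : Fin (r + 1)) (x : X) :
    fiber (relTrace R (j.removeNth t)) x = fiber (fun x ↦ (relTrace R t x).erase j) x := by
  ext x'
  simp [mem_fiber, Finset.ext_iff, mem_relTrace, Fin.forall_iff_succAbove j, Fin.removeNth]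

theorem vcDim_image_relTrace_le [Fintype X] {ι : Type*} [Fintype ι] [DecidableEq ι]
    {R : X → Y → Prop} {k : ℕ} (hR : ¬RelShatters R k) (t : ι → Y) :
    (univ.image (relTrace R t)).vcDim ≤ k := by
  refine Finset.sup_le fun s hs ↦ ?_
  by_contra! hk
  obtain ⟨s', hs's, hcard⟩ := exists_subset_card_eq hk.le
  let e : Fin k ↪ ι :=
    (s'.equivFinOfCardEq hcard).symm.toEmbedding.trans (Function.Embedding.subtype _)
  have he (i : Fin k) : e i ∈ s' := ((s'.equivFinOfCardEq hcard).symm i).2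
  have htrace (S : Finset (Fin k)) : ∃ x, s' ∩ relTrace R t x = S.map e := by
    have hS : S.map e ⊆ s' := map_subset_iff_subset_preimage.2 fun i _ ↦ by simp [he]
    obtain ⟨u, hu, hsu⟩ := (mem_shatterer.1 hs).mono_right hs's hS
    obtain ⟨x, -, rfl⟩ := mem_image.1 hu
    exact ⟨x, hsu⟩
  choose b hb using htrace
  refine hR ⟨t ∘ e, b, fun i S ↦ ?_⟩
  simpa [he i, mem_relTrace] using congrArg (e i ∈ ·) (hb S)

variable [Fintype Y]

/-- The normalized Hamming distance between the rows of `x` and `x'` in the matrix `R`. -/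
noncomputable def rowDist (R : X → Y → Prop) (x x' : X) : ℝ :=
  𝔼 y, |iverson (R x y) - iverson (R x' y)|

theorem rowDist_comm (R : X → Y → Prop) (x x' : X) : rowDist R x x' = rowDist R x' x := by
  simp only [rowDist, abs_sub_comm]

theorem rowDist_triangle (R : X → Y → Prop) (x x' x'' : X) :
    rowDist R x x'' ≤ rowDist R x x' + rowDist R x' x'' := by
  simp only [rowDist, ← expect_add_distrib]
  exact expect_le_expect fun y _ ↦ abs_sub_le _ _ _

theorem rowDist_nonneg (R : X → Y → Prop) (x x' : X) : 0 ≤ rowDist R x x' :=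
  expect_nonneg fun _ _ ↦ abs_nonneg _

theorem rowDist_le_one [Nonempty Y] (R : X → Y → Prop) (x x' : X) : rowDist R x x' ≤ 1 :=
  expect_le univ_nonempty fun _ _ ↦ abs_iverson_sub_le_one _ _

variable [Fintype X] {ι : Type*} [Fintype ι]

/-- The mean distance from the row of `x` to the rows with the same trace on the sample `t`. -/
noncomputable def traceDefect (R : X → Y → Prop) (t : ι → Y) (x : X) : ℝ :=
  𝔼 x' ∈ fiber (relTrace R t) x, rowDist R x x'

theorem traceDefect_nonneg (R : X → Y → Prop) (t : ι → Y) (x : X) : 0 ≤ traceDefect R t x :=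
  expect_nonneg fun _ _ ↦ rowDist_nonneg R _ _

theorem rowDist_le_of_relTrace_eq {R : X → Y → Prop} {t : ι → Y} {x x' : X}
    (h : relTrace R t x' = relTrace R t x) :
    rowDist R x x' ≤ traceDefect R t x + traceDefect R t x' := by
  rw [traceDefect, traceDefect, fiber_congr h, ← expect_add_distrib]
  exact le_expect (fiber_nonempty _ x) fun w _ ↦
    (rowDist_triangle R x w x').trans_eq (by rw [rowDist_comm R w])

theorem rowDist_le [Nonempty Y] (R : X → Y → Prop) (t : ι → Y) (x x' : X) :
    rowDist R x x' ≤ traceDefect R t x + traceDefect R t x' +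
      ∑ j, |iverson (R x (t j)) - iverson (R x' (t j))| := by
  by_cases h : relTrace R t x' = relTrace R t x
  · exact (rowDist_le_of_relTrace_eq h).trans
      (le_add_of_nonneg_right (sum_nonneg fun _ _ ↦ abs_nonneg _))
  · obtain ⟨j, hj⟩ : ∃ j, ¬(R x (t j) ↔ R x' (t j)) := by
      by_contra! hall
      exact h (ext fun j ↦ by simp only [mem_relTrace, hall])
    refine (rowDist_le_one R x x').trans (le_add_of_nonneg_of_le
      (add_nonneg (traceDefect_nonneg R t x) (traceDefect_nonneg R t x')) ?_)
    exact (abs_iverson_sub_eq_one hj).ge.trans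
      (single_le_sum (f := fun j ↦ |iverson (R x (t j)) - iverson (R x' (t j))|)
        (fun _ _ ↦ abs_nonneg _) (mem_univ j))

end Sampling

section Exchangeability

variable {Y : Type*} [Fintype Y] {r : ℕ}

theorem expect_removeNth (F : (Fin r → Y) → Y → ℝ) (j : Fin (r + 1)) :
    𝔼 t : Fin (r + 1) → Y, F (j.removeNth t) (t j) = 𝔼 t : Fin r → Y, 𝔼 y, F t y := by
  rw [expect_comm, ← expect_product' univ univ fun y t ↦ F t y]
  refine (Fintype.expect_equiv (Fin.insertNthEquiv (fun _ ↦ Y) j) _ _ fun p ↦ ?_).symm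
  simp [Fin.insertNthEquiv]

theorem expect_expect_eq_expect_sum_removeNth (F : (Fin r → Y) → Y → ℝ) :
    𝔼 t : Fin r → Y, 𝔼 y, F t y =
      (𝔼 t : Fin (r + 1) → Y, ∑ j, F (j.removeNth t) (t j)) / (r + 1) := by
  rw [expect_sum_comm, eq_div_iff (by positivity)]
  simp [expect_removeNth, mul_comm]

variable {X : Type*} [Fintype X]

/-- The point `y` at which two rows are compared and the sample `t` together form `r + 1`
exchangeable points, so that the mean error is a leave-one-out error. -/
theorem expect_expect_traceDefect_le {R : X → Y → Prop} {k : ℕ} (hR : ¬RelShatters R k) (r : ℕ) :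
    𝔼 t : Fin r → Y, 𝔼 x, traceDefect R t x ≤ 2 * k / (r + 1) := by
  set F : (Fin r → Y) → Y → ℝ := fun t y ↦
    𝔼 x, 𝔼 x' ∈ fiber (relTrace R t) x, |iverson (R x y) - iverson (R x' y)|
  have hF (t : Fin r → Y) : 𝔼 x, traceDefect R t x = 𝔼 y, F t y := by
    simp only [F, traceDefect, rowDist]
    rw [expect_comm univ univ]
    exact expect_congr rfl fun x _ ↦ expect_comm _ _ _
  have hleave (t : Fin (r + 1) → Y) : ∑ j, F (j.removeNth t) (t j) ≤ 2 * k := by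
    calc ∑ j, F (j.removeNth t) (t j)
        = (∑ j, ∑ x, 𝔼 x' ∈ fiber (fun x ↦ (relTrace R t x).erase j) x,
            |iverson (j ∈ relTrace R t x) - iverson (j ∈ relTrace R t x')|) / Fintype.card X := by
          simp only [F, fiber_relTrace_removeNth, mem_relTrace, sum_div,
            Fintype.expect_eq_sum_div_card]
      _ ≤ 2 * (univ.image (relTrace R t)).vcDim :=
          div_le_of_le_mul₀ (by positivity) (by positivity)
            ((sum_sum_expect_fiber_erase_le _).trans_eq (mul_assoc _ _ _).symm)
      _ ≤ 2 * k := by gcongr; exact vcDim_image_relTrace_le hR t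
  simp only [hF]
  rw [expect_expect_eq_expect_sum_removeNth]
  gcongr
  rcases isEmpty_or_nonempty Y
  · simp
  · exact expect_le univ_nonempty fun t _ ↦ hleave t

theorem exists_expect_expect_traceDefect_le {I : Type*} [Fintype I] [Nonempty Y]
    {R : I → X → Y → Prop} {k : ℕ} (hR : ∀ i, ¬RelShatters (R i) k) (r : ℕ) :
    ∃ t : Fin r → Y, 𝔼 i, 𝔼 x, traceDefect (R i) t x ≤ 2 * k / (r + 1) := by
  have hmean : 𝔼 t : Fin r → Y, 𝔼 i, 𝔼 x, traceDefect (R i) t x ≤ 2 * k / (r + 1) := by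
    rw [expect_comm]
    rcases isEmpty_or_nonempty I
    · simp only [univ_eq_empty, expect_empty]
      positivity
    · exact expect_le univ_nonempty fun i _ ↦ expect_expect_traceDefect_le (hR i) r
  simpa using exists_le_of_expect_le univ_nonempty hmean

end Exchangeability

section DoubleSampling

variable {X Y Z : Type*} [Fintype X] [Fintype Y] [Fintype Z]

/-- The normalized Hamming distance between the slices of `x` and `x'` in the ternary relation
`T`. -/
noncomputable def sliceDist (T : X → Y → Z → Prop) (x x' : X) : ℝ :=
  𝔼 y, 𝔼 z, |iverson (T x y z) - iverson (T x' y z)|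

theorem sliceDist_le [Nonempty Z] (T : X → Y → Z → Prop) {r : ℕ} (t : Fin r → Z) (x x' : X) :
    sliceDist T x x' ≤
      𝔼 y, traceDefect (fun x z ↦ T x y z) t x + 𝔼 y, traceDefect (fun x z ↦ T x y z) t x' +
        ∑ i, rowDist (fun x y ↦ T x y (t i)) x x' := by
  simp only [rowDist]
  rw [← expect_sum_comm, ← expect_add_distrib, ← expect_add_distrib]
  exact expect_le_expect fun y _ ↦ rowDist_le (fun x z ↦ T x y z) t _ _

/-- A sample `t` of `Z` almost determines the slice of `x` up to its traces on the relations
`T · · (t i)`, and a second sample, of `Y`, almost determines these traces. -/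
theorem exists_coloring_expect_sliceDist_le {T : X → Y → Z → Prop}
    {k : ℕ} (hY : ∀ y, ¬RelShatters (fun x z ↦ T x y z) k)
    (hZ : ∀ z, ¬RelShatters (fun x y ↦ T x y z) k) (r s : ℕ) :
    ∃ f : X → Fin r → Finset (Fin s),
      𝔼 x, 𝔼 x' ∈ fiber f x, sliceDist T x x' ≤ 4 * k * (1 / (r + 1) + r / (s + 1)) := by
  have hbound : (0 : ℝ) ≤ 4 * k * (1 / (r + 1) + r / (s + 1)) := by positivity
  rcases isEmpty_or_nonempty Y
  · exact ⟨fun _ _ ↦ ∅, by simpa only [sliceDist, univ_eq_empty, expect_empty, expect_const_zero]⟩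
  rcases isEmpty_or_nonempty Z
  · exact ⟨fun _ _ ↦ ∅, by simpa only [sliceDist, univ_eq_empty, expect_empty, expect_const_zero]⟩
  obtain ⟨t, ht⟩ := exists_expect_expect_traceDefect_le hY r
  obtain ⟨w, hw⟩ := exists_expect_expect_traceDefect_le (fun i ↦ hZ (t i)) s
  let c (x : X) : ℝ := 𝔼 y, traceDefect (fun x z ↦ T x y z) t x +
    ∑ i, traceDefect (fun x y ↦ T x y (t i)) w x
  have hc : 𝔼 x, c x ≤ 2 * k / (r + 1) + r * (2 * k / (s + 1)) := by
    rw [expect_add_distrib, expect_sum_comm, expect_comm, ← Fintype.card_mul_expect,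
      Fintype.card_fin]
    gcongr
  let f (x : X) (i : Fin r) : Finset (Fin s) := relTrace (fun x y ↦ T x y (t i)) w x
  refine ⟨f, ?_⟩
  have hdist (x x' : X) (hx' : x' ∈ fiber f x) : sliceDist T x x' ≤ c x + c x' := by
    have hrow : ∑ i, rowDist (fun x y ↦ T x y (t i)) x x' ≤
        ∑ i, traceDefect (fun x y ↦ T x y (t i)) w x +
          ∑ i, traceDefect (fun x y ↦ T x y (t i)) w x' := by
      rw [← sum_add_distrib]
      exact sum_le_sum fun i _ ↦ rowDist_le_of_relTrace_eq (congrFun (mem_fiber.1 hx') i)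
    linarith [sliceDist_le T t x x']
  calc 𝔼 x, 𝔼 x' ∈ fiber f x, sliceDist T x x'
      ≤ 𝔼 x, 𝔼 x' ∈ fiber f x, (c x + c x') :=
        expect_le_expect fun x _ ↦ expect_le_expect (hdist x)
    _ = 2 * 𝔼 x, c x := expect_expect_fiber_add f c
    _ ≤ 2 * (2 * k / (r + 1) + r * (2 * k / (s + 1))) := by gcongr
    _ = 4 * k * (1 / (r + 1) + r / (s + 1)) := by ring

end DoubleSampling

section BoxMean

variable {X Y Z C : Type*} [Fintype X] [Fintype Y] [Fintype Z]

theorem expect_abs_sub_expect_fiber_le (f : X → C) (g h : X → ℝ) :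
    𝔼 x, |g x - 𝔼 x' ∈ fiber f x, h x'| ≤
      𝔼 x, 𝔼 x' ∈ fiber f x, |g x - g x'| + 𝔼 x, |g x - h x| := by
  rw [← expect_expect_fiber f fun x ↦ |g x - h x|, ← expect_add_distrib]
  refine expect_le_expect fun x _ ↦ ?_
  calc |g x - 𝔼 x' ∈ fiber f x, h x'| = |𝔼 x' ∈ fiber f x, (g x - h x')| := by
        rw [expect_sub_distrib, expect_const (fiber_nonempty f x)]
    _ ≤ 𝔼 x' ∈ fiber f x, |g x - h x'| := abs_expect_le _ _
    _ ≤ 𝔼 x' ∈ fiber f x, (|g x - g x'| + |g x' - h x'|) :=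
        expect_le_expect fun x' _ ↦ abs_sub_le _ _ _
    _ = _ := expect_add_distrib _ _ _

theorem expect_expect_abs_sub_expect_fiber_le {W : Type*} [Fintype W] (f : X → C)
    (g h : W → X → ℝ) :
    𝔼 w, 𝔼 x, |g w x - 𝔼 x' ∈ fiber f x, h w x'| ≤
      𝔼 w, 𝔼 x, 𝔼 x' ∈ fiber f x, |g w x - g w x'| + 𝔼 w, 𝔼 x, |g w x - h w x| := by
  rw [← expect_add_distrib]
  exact expect_le_expect fun w _ ↦ expect_abs_sub_expect_fiber_le f (g w) (h w)

theorem expect_abs_sub_expect_fiber₂_le (f₁ : X → C) (f₂ : Y → C) (g : X → Y → ℝ) :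
    𝔼 x, 𝔼 y, |g x y - 𝔼 x' ∈ fiber f₁ x, 𝔼 y' ∈ fiber f₂ y, g x' y'| ≤
      𝔼 y, 𝔼 x, 𝔼 x' ∈ fiber f₁ x, |g x y - g x' y| +
        𝔼 x, 𝔼 y, 𝔼 y' ∈ fiber f₂ y, |g x y - g x y'| := by
  rw [expect_comm]
  refine (expect_expect_abs_sub_expect_fiber_le f₁ (fun y x ↦ g x y) fun y x ↦
    𝔼 y' ∈ fiber f₂ y, g x y').trans (add_le_add_right ?_ _)
  rw [expect_comm]
  simpa using expect_expect_abs_sub_expect_fiber_le f₂ g g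

theorem expect_rotate (F : X → Y → Z → ℝ) :
    𝔼 x, 𝔼 y, 𝔼 z, F x y z = 𝔼 y, 𝔼 z, 𝔼 x, F x y z := by
  rw [expect_comm]
  exact expect_congr rfl fun y _ ↦ expect_comm _ _ _

/-- The coordinates are replaced by random points of their color classes one at a time. -/
theorem expect_abs_sub_expect_fiber₃_le (f₁ : X → C) (f₂ : Y → C) (f₃ : Z → C)
    (g : X → Y → Z → ℝ) :
    𝔼 x, 𝔼 y, 𝔼 z,
        |g x y z - 𝔼 x' ∈ fiber f₁ x, 𝔼 y' ∈ fiber f₂ y, 𝔼 z' ∈ fiber f₃ z, g x' y' z'| ≤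
      𝔼 y, 𝔼 z, 𝔼 x, 𝔼 x' ∈ fiber f₁ x, |g x y z - g x' y z| +
        (𝔼 x, 𝔼 z, 𝔼 y, 𝔼 y' ∈ fiber f₂ y, |g x y z - g x y' z| +
          𝔼 x, 𝔼 y, 𝔼 z, 𝔼 z' ∈ fiber f₃ z, |g x y z - g x y z'|) := by
  calc _ = 𝔼 y, 𝔼 z, 𝔼 x,
        |g x y z - 𝔼 x' ∈ fiber f₁ x, 𝔼 y' ∈ fiber f₂ y, 𝔼 z' ∈ fiber f₃ z, g x' y' z'| :=
        expect_rotate _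
    _ ≤ 𝔼 y, (𝔼 z, 𝔼 x, 𝔼 x' ∈ fiber f₁ x, |g x y z - g x' y z| +
          𝔼 z, 𝔼 x, |g x y z - 𝔼 y' ∈ fiber f₂ y, 𝔼 z' ∈ fiber f₃ z, g x y' z'|) :=
        expect_le_expect fun y _ ↦ expect_expect_abs_sub_expect_fiber_le f₁
          (fun z x ↦ g x y z) fun z x ↦ 𝔼 y' ∈ fiber f₂ y, 𝔼 z' ∈ fiber f₃ z, g x y' z'
    _ = 𝔼 y, 𝔼 z, 𝔼 x, 𝔼 x' ∈ fiber f₁ x, |g x y z - g x' y z| +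
          𝔼 x, 𝔼 y, 𝔼 z, |g x y z - 𝔼 y' ∈ fiber f₂ y, 𝔼 z' ∈ fiber f₃ z, g x y' z'| := by
        rw [expect_add_distrib, add_right_inj]
        exact (expect_rotate _).symm
    _ ≤ _ := by
        refine add_le_add_right ?_ _
        rw [← expect_add_distrib]
        exact expect_le_expect fun x _ ↦ expect_abs_sub_expect_fiber₂_le f₂ f₃ (g x)

theorem expect_abs_sub_expect_fiber₃_le_three_mul_sliceDist {T : X → X → X → Prop}
    (hswap : ∀ x y z, T x y z ↔ T y x z) (hrotate : ∀ x y z, T x y z ↔ T z x y) (f : X → C) :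
    𝔼 x, 𝔼 y, 𝔼 z, |iverson (T x y z) -
        𝔼 x' ∈ fiber f x, 𝔼 y' ∈ fiber f y, 𝔼 z' ∈ fiber f z, iverson (T x' y' z')| ≤
      3 * 𝔼 x, 𝔼 x' ∈ fiber f x, sliceDist T x x' := by
  have hS : 𝔼 x, 𝔼 x' ∈ fiber f x, sliceDist T x x' =
      𝔼 y, 𝔼 z, 𝔼 x, 𝔼 x' ∈ fiber f x, |iverson (T x y z) - iverson (T x' y z)| := by
    simp only [sliceDist]
    rw [expect_congr rfl fun x _ ↦ expect_comm (fiber f x) univ _, expect_comm]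
    refine expect_congr rfl fun y _ ↦ ?_
    rw [expect_congr rfl fun x _ ↦ expect_comm (fiber f x) univ _, expect_comm]
  refine (expect_abs_sub_expect_fiber₃_le f f f fun x y z ↦ iverson (T x y z)).trans_eq ?_
  have h₂ : 𝔼 x, 𝔼 z, 𝔼 y, 𝔼 y' ∈ fiber f y, |iverson (T x y z) - iverson (T x y' z)| =
      𝔼 x, 𝔼 x' ∈ fiber f x, sliceDist T x x' := by
    rw [hS]
    simp only [hswap]
  have h₃ : 𝔼 x, 𝔼 y, 𝔼 z, 𝔼 z' ∈ fiber f z, |iverson (T x y z) - iverson (T x y z')| =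
      𝔼 x, 𝔼 x' ∈ fiber f x, sliceDist T x x' := by
    rw [hS]
    simp only [hrotate]
  rw [← hS, h₂, h₃]
  ring

end BoxMean

section Homogeneity

theorem not_hasShattered_of_vcDimension_lt {V : Type*} {G : SimpleGraph V} {k : ℕ}
    (h : G.vcDimension < (k : ℕ∞)) : ¬G.HasShattered k := fun hk ↦
  h.not_ge (le_iSup₂ (f := fun (d : ℕ) (_ : G.HasShattered d) ↦ (d : ℕ∞)) k hk)

variable {V C : Type*} [Fintype V] [DecidableEq V] (f : V → C)
  [DecidableRel (Setoid.ker f).r]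

theorem part_ofSetoid_ker (x : V) : (Finpartition.ofSetoid (Setoid.ker f)).part x = fiber f x := by
  ext x'
  rw [Finpartition.mem_part_ofSetoid_iff_rel, Setoid.ker_def, mem_fiber, eq_comm]

theorem card_parts_ofSetoid_ker_le [Fintype C] :
    #(Finpartition.ofSetoid (Setoid.ker f)).parts ≤ Fintype.card C := by
  classical
  have hsub : (Finpartition.ofSetoid (Setoid.ker f)).parts ⊆
      univ.image fun c ↦ ({x | f x = c} : Finset V) := by
    intro A hA
    obtain ⟨x, hx⟩ := (Finpartition.ofSetoid (Setoid.ker f)).nonempty_of_mem_parts hA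
    refine mem_image.2 ⟨f x, mem_univ _, ?_⟩
    rw [← Finpartition.part_eq_of_mem _ hA hx, part_ofSetoid_ker]
    ext x'
    simp [mem_fiber]
  exact (card_le_card hsub).trans card_image_le

end Homogeneity

namespace ThreeGraph

variable {V : Type*} [DecidableEq V] (H : ThreeGraph V)

/-- The symmetric ternary relation of spanning an edge of `H`. -/
def IsEdge (x y z : V) : Prop := ({x, y, z} : Finset V) ∈ H.edges

theorem isEdge_swap (x y z : V) : H.IsEdge x y z ↔ H.IsEdge y x z := by
  rw [IsEdge, insert_comm, IsEdge]

theorem isEdge_rotate (x y z : V) : H.IsEdge x y z ↔ H.IsEdge z x y := by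
  rw [IsEdge, pair_comm, insert_comm, IsEdge]

theorem slice_adj_iff (x y z : V) : (H.slice x).Adj y z ↔ H.IsEdge x y z := by
  refine ⟨fun h ↦ h.2, fun h ↦ ⟨?_, h⟩⟩
  rintro rfl
  have hcard := H.card_eq_three _ h
  rw [pair_eq_singleton] at hcard
  exact absurd hcard (card_le_two.trans_lt (by norm_num)).ne

theorem not_relShatters_isEdge_middle {k : ℕ} (h : H.slicewiseVC < (k : ℕ∞)) (y : V) :
    ¬RelShatters (fun x z ↦ H.IsEdge x y z) k := by
  rintro ⟨a, b, hab⟩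
  have hy : (H.slice y).vcDimension < (k : ℕ∞) :=
    (le_iSup (fun y ↦ (H.slice y).vcDimension) y).trans_lt h
  refine not_hasShattered_of_vcDimension_lt hy ⟨a, b, fun i S ↦ ?_⟩
  rw [slice_adj_iff, ← hab, isEdge_rotate]

theorem not_relShatters_isEdge_right {k : ℕ} (h : H.slicewiseVC < (k : ℕ∞)) (z : V) :
    ¬RelShatters (fun x y ↦ H.IsEdge x y z) k := by
  simpa only [H.isEdge_rotate _ _ z, H.isEdge_swap z] using H.not_relShatters_isEdge_middle h z

theorem density_eq_expect (X Y Z : Finset V) :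
    H.density X Y Z = 𝔼 x ∈ X, 𝔼 y ∈ Y, 𝔼 z ∈ Z, iverson (H.IsEdge x y z) := by
  simp only [← expect_product' _ _ fun y z ↦ iverson (H.IsEdge _ y z)]
  rw [← expect_product' X (Y ×ˢ Z) fun x p ↦ iverson (H.IsEdge x p.1 p.2),
    expect_eq_sum_div_card, density, card_filter, Nat.cast_sum, card_product, card_product]
  push_cast
  rw [mul_assoc]
  congr! 2 with t
  unfold iverson IsEdge
  congr

theorem density_mem_Icc (X Y Z : Finset V) : H.density X Y Z ∈ Set.Icc (0 : ℝ) 1 := by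
  refine ⟨by unfold density; positivity, div_le_one_of_le₀ ?_ (by positivity)⟩
  rw [mul_assoc, ← Nat.cast_mul, ← Nat.cast_mul, ← card_product, ← card_product]
  exact_mod_cast card_filter_le _ _

theorem le_abs_iverson_sub_density {ε : ℝ} {X Y Z : Finset V}
    (h : ¬H.IsHomogeneousTriple ε X Y Z) (p : Prop) : ε ≤ |iverson p - H.density X Y Z| := by
  obtain ⟨hnonneg, hle_one⟩ := H.density_mem_Icc X Y Z
  simp only [IsHomogeneousTriple, Set.mem_union, Set.mem_Ico, Set.mem_Ioc, hnonneg, hle_one,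
    true_and, and_true, not_or, not_lt] at h
  by_cases hp : p
  · rw [iverson, if_pos hp]
    exact (le_sub_comm.1 h.2).trans (le_abs_self _)
  · rw [iverson, if_neg hp, abs_sub_comm, sub_zero]
    exact h.1.trans (le_abs_self _)

theorem isHomogeneousPartition_of_expect_le [Fintype V] {C : Type*} (f : V → C)
    [DecidableRel (Setoid.ker f).r] {ε : ℝ} (hε : 0 < ε)
    (h : 𝔼 x, 𝔼 y, 𝔼 z, |iverson (H.IsEdge x y z) -
      H.density (fiber f x) (fiber f y) (fiber f z)| ≤ ε ^ 2) :
    H.IsHomogeneousPartition ε (Finpartition.ofSetoid (Setoid.ker f)) := by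
  classical
  set P := Finpartition.ofSetoid (Setoid.ker f)
  let error (t : V × V × V) : ℝ := |iverson (H.IsEdge t.1 t.2.1 t.2.2) -
    H.density (fiber f t.1) (fiber f t.2.1) (fiber f t.2.2)|
  unfold IsHomogeneousPartition
  set good : Finset (V × V × V) := {t | ∃ X ∈ P.parts, ∃ Y ∈ P.parts, ∃ Z ∈ P.parts,
    H.IsHomogeneousTriple ε X Y Z ∧ t.1 ∈ X ∧ t.2.1 ∈ Y ∧ t.2.2 ∈ Z}
  have hbad (t : V × V × V) (ht : t ∈ goodᶜ) : ε ≤ error t := by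
    refine H.le_abs_iverson_sub_density (fun hom ↦ mem_compl.1 ht ?_) _
    simp only [← part_ofSetoid_ker] at hom
    exact mem_filter.2 ⟨mem_univ t, _, P.part_mem.2 (mem_univ _), _, P.part_mem.2 (mem_univ _), _,
      P.part_mem.2 (mem_univ _), hom, by simp [P], by simp [P], by simp [P]⟩
  have hcard : (Fintype.card (V × V × V) : ℝ) = Fintype.card V ^ 3 := by
    simp only [Fintype.card_prod]
    push_cast
    ring
  have hmarkov : ε * #goodᶜ ≤ ε * (ε * Fintype.card V ^ 3) := by
    calc ε * #goodᶜ = #goodᶜ • ε := by rw [nsmul_eq_mul, mul_comm]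
      _ ≤ ∑ t ∈ goodᶜ, error t := card_nsmul_le_sum _ _ _ hbad
      _ ≤ ∑ t, error t := sum_le_univ_sum_of_nonneg fun t ↦ abs_nonneg _
      _ = Fintype.card V ^ 3 * 𝔼 x, 𝔼 y, 𝔼 z, error (x, y, z) := by
          rw [← hcard, ← Fintype.card_mul_expect, ← univ_product_univ, expect_product]
          simp only [← univ_product_univ, expect_product]
      _ ≤ Fintype.card V ^ 3 * ε ^ 2 := by gcongr
      _ = ε * (ε * Fintype.card V ^ 3) := by ring
  have htotal : (#good : ℝ) + #goodᶜ = Fintype.card V ^ 3 := by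
    rw [← Nat.cast_add, card_add_card_compl, hcard]
  linarith [le_of_mul_le_mul_left hmarkov hε]

end ThreeGraph

theorem sampling_error_le (k r : ℕ) :
    4 * k * (1 / (r + 1) + r / (((r + 1) ^ 2 : ℕ) + 1)) ≤ 8 * k / (r + 1 : ℝ) := by
  have hr : (r : ℝ) / (((r + 1) ^ 2 : ℕ) + 1) ≤ 1 / (r + 1) := by
    rw [div_le_div_iff₀ (by positivity) (by positivity)]
    push_cast
    nlinarith
  calc _ ≤ 4 * k * (1 / (r + 1) + 1 / (r + 1 : ℝ)) := by gcongr
    _ = _ := by ring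

theorem theorem1p4_general {k : ℕ} {ε : ℝ} (hε : 0 < ε) {V : Type*} [Fintype V] [DecidableEq V]
    {H : ThreeGraph V} (hH : H.slicewiseVC < (k : ℕ∞)) :
    ∃ P : Finpartition (univ : Finset V),
      H.IsHomogeneousPartition ε P ∧ (#P.parts : ℝ) ≤ 2 ^ ((24 * k / ε ^ 2 + 1) ^ 3) := by
  classical
  set r := ⌊24 * k / ε ^ 2⌋₊
  obtain ⟨f, hf⟩ := exists_coloring_expect_sliceDist_le (H.not_relShatters_isEdge_middle hH)
    (H.not_relShatters_isEdge_right hH) r ((r + 1) ^ 2)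
  refine ⟨Finpartition.ofSetoid (Setoid.ker f), ?_, ?_⟩
  · refine H.isHomogeneousPartition_of_expect_le f hε ?_
    simp only [H.density_eq_expect]
    calc _ ≤ 3 * 𝔼 x, 𝔼 x' ∈ fiber f x, sliceDist H.IsEdge x x' :=
          expect_abs_sub_expect_fiber₃_le_three_mul_sliceDist H.isEdge_swap H.isEdge_rotate f
      _ ≤ 3 * (8 * k / (r + 1)) := by gcongr; exact hf.trans (sampling_error_le k r)
      _ = 24 * k / (r + 1) := by ring
      _ ≤ ε ^ 2 := div_le_of_le_mul₀ (by positivity) (by positivity)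
          ((div_le_iff₀' (by positivity)).1 (Nat.lt_floor_add_one _).le)
  · have hr : (r : ℝ) ≤ 24 * k / ε ^ 2 := Nat.floor_le (by positivity)
    calc (#(Finpartition.ofSetoid (Setoid.ker f)).parts : ℝ)
        ≤ Fintype.card (Fin r → Finset (Fin ((r + 1) ^ 2))) :=
          Nat.cast_le.2 (card_parts_ofSetoid_ker_le f)
      _ = 2 ^ (((r + 1) ^ 2 * r : ℕ) : ℝ) := by
          rw [Real.rpow_natCast, pow_mul]
          simp
      _ ≤ 2 ^ ((24 * k / ε ^ 2 + 1) ^ 3) := by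
          gcongr
          · norm_num
          calc (((r + 1) ^ 2 * r : ℕ) : ℝ) ≤ (r + 1) ^ 3 := by
                push_cast
                nlinarith
            _ ≤ _ := by gcongr

theorem exponent_le_two_rpow {k : ℕ} (hk : 1 ≤ k) {ε : ℝ} (hε : 0 < ε)
    (hεk : ε < 1 / (25 * k) ^ 3) :
    (24 * k / ε ^ 2 + 1) ^ 3 ≤ (2 : ℝ) ^ ε ^ (-7 : ℝ) := by
  have hk1 : (1 : ℝ) ≤ k := Nat.one_le_cast.2 hk
  have hε1 : ε ≤ 1 := hεk.le.trans (div_le_one_of_le₀ (one_le_pow₀ (by linarith)) (by positivity))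
  have hone : 1 ≤ k / ε ^ 2 :=
    (one_le_div (by positivity)).2 ((pow_le_one₀ hε.le hε1).trans hk1)
  calc (24 * k / ε ^ 2 + 1) ^ 3 ≤ (25 * (k / ε ^ 2)) ^ 3 := by
        gcongr
        linarith [mul_div_assoc 24 (k : ℝ) (ε ^ 2)]
    _ = (25 * k) ^ 3 * (ε ^ 6)⁻¹ := by field_simp
    _ ≤ ε⁻¹ * (ε ^ 6)⁻¹ := by
        gcongr
        exact (le_inv_comm₀ (by positivity) hε).2 (hεk.le.trans_eq (one_div _))
    _ = ε ^ (-7 : ℝ) := by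
        rw [← mul_inv, ← pow_succ', Real.rpow_neg hε.le]
        norm_cast
    _ ≤ 1 + ε ^ (-7 : ℝ) * 1 := by linarith
    _ ≤ (1 + 1) ^ ε ^ (-7 : ℝ) := one_add_mul_self_le_rpow_one_add (by norm_num)
        (Real.one_le_rpow_of_pos_of_le_one_of_nonpos hε hε1 (by norm_num))
    _ = 2 ^ ε ^ (-7 : ℝ) := by norm_num

theorem theorem1p4 (k : ℕ) (hk : 1 ≤ k) :
    ∃ K : ℝ, 0 < K ∧ ∃ εstar : ℝ, 0 < εstar ∧
      ∀ ε : ℝ, 0 < ε → ε < εstar →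
        ∃ N : ℕ, ∀ (V : Type*) [Fintype V] [DecidableEq V] (H : ThreeGraph V),
          N ≤ Fintype.card V → H.slicewiseVC < (k : ℕ∞) →
            ∃ P : Finpartition (Finset.univ : Finset V),
              H.IsHomogeneousPartition ε P ∧
                (P.parts.card : ℝ) ≤ (2 : ℝ) ^ ((2 : ℝ) ^ (ε ^ (-K))) := by
  refine ⟨7, by norm_num, 1 / (25 * k) ^ 3, by positivity, fun ε hε hεk ↦
    ⟨0, fun V _ _ H _ hH ↦ ?_⟩⟩
  obtain ⟨P, hP, hcard⟩ := theorem1p4_general hε hH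
  exact ⟨P, hP, hcard.trans
    (Real.rpow_le_rpow_of_exponent_le one_le_two (exponent_le_two_rpow hk hε hεk))⟩
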